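/- Let $A$ be a commutative ring and let $I\subset A$ be an ideal generated by a regular sequence $f=a_0,a_1,\ldots,a_r$ ($r\ge 0$), i.e. for every $i$ the class of $a_i$ is a non-zero-divisor on $A/(a_0,\ldots,a_{i-1})$ (the case $I=A$ is allowed). Let $A[It]=\bigoplus_{n\ge 0}I^nt^n\subset A[t]$ be the Rees algebra, let $\pi:\tilde X=\mathrm{Proj}_A(A[It])\to X=\mathrm{Spec}(A)$ be the blow-up of $X$ with centre $I$, and let $D=\mathrm{div}(f)=\mathrm{Spec}(A/fA)\subset X$. The proper transform of $D$ is the closed subscheme $\mathrm{Proj}_A\big(A[It]/(ft)\big)$ of $\tilde X$, where $ft$ is the element of degree $1$ defined by $f\in I$; the strict transform of $D$ is the closure in $\tilde X$ of $\pi^{-1}(D\setminus V(I))$, with the structure of schematic closure (the scheme-theoretic image of $\pi^{-1}(D\setminus V(I))=\tilde X\times_X (D\setminus V(I))$ in $\tilde X$). Then the proper transform and the strict transform of $D$ coincide as closed subschemes of $\tilde X$: there is an isomorphism between them compatible with the morphisms to $\tilde X$. In particular, the underlying set of the proper transform is the topological closure of $\pi^{-1}(V(f)\setminus V(I))$. 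-/

import Mathlib

open CategoryTheory CategoryTheory.Limits AlgebraicGeometry Polynomial DirectSum

universe u

noncomputable section

namespace AffineModification

section Quotient

variable {R S : Type u} [CommRing R] [CommRing S] [Algebra R S]
  (𝒜 : ℕ → Submodule R S) [GradedAlgebra 𝒜] (J : HomogeneousIdeal 𝒜)

/-- The grading of the quotient `S ⧸ J` of a graded algebra by a homogeneous ideal:
the degree `n` piece is the image of the degree `n` piece of `S`. -/
def quotientGrading (n : ℕ) : Submodule R (S ⧸ J.toIdeal) :=
  (𝒜 n).map (Ideal.Quotient.mkₐ R J.toIdeal).toLinearMap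

/-- The projection from `S` to its homogeneous components modulo `J`. -/
def quotientDecomposeAux : S →ₗ[R] ⨁ n, quotientGrading 𝒜 J n :=
  (DirectSum.toModule R ℕ (⨁ n, quotientGrading 𝒜 J n) fun n ↦
    (DirectSum.lof R ℕ (fun n ↦ quotientGrading 𝒜 J n) n).comp
      ((Ideal.Quotient.mkₐ R J.toIdeal).toLinearMap.submoduleMap (𝒜 n))).comp
    (DirectSum.decomposeLinearEquiv 𝒜).toLinearMap

theorem quotientDecomposeAux_of_mem {n : ℕ} {x : S} (hx : x ∈ 𝒜 n) :
    quotientDecomposeAux 𝒜 J x =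
      DirectSum.lof R ℕ (fun n ↦ quotientGrading 𝒜 J n) n
        ⟨Ideal.Quotient.mk J.toIdeal x, Submodule.mem_map_of_mem hx⟩ := by
  lift x to 𝒜 n using hx
  simp only [quotientDecomposeAux, LinearMap.comp_apply, LinearEquiv.coe_coe,
    decomposeLinearEquiv_apply, decompose_coe, ← DirectSum.lof_eq_of R, DirectSum.toModule_lof]
  rfl

theorem quotientDecomposeAux_eq_zero {x : S} (hx : x ∈ J.toIdeal) :
    quotientDecomposeAux 𝒜 J x = 0 := by
  classical
  rw [← DirectSum.sum_support_decompose 𝒜 x, map_sum]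
  refine Finset.sum_eq_zero fun n _ ↦ ?_
  rw [quotientDecomposeAux_of_mem 𝒜 J (SetLike.coe_mem _)]
  have h0 : (⟨Ideal.Quotient.mk J.toIdeal (DirectSum.decompose 𝒜 x n : S),
      Submodule.mem_map_of_mem (SetLike.coe_mem _)⟩ : quotientGrading 𝒜 J n) = 0 :=
    Subtype.ext (Ideal.Quotient.eq_zero_iff_mem.mpr (J.isHomogeneous n hx))
  rw [h0, map_zero]

/-- The decomposition of an element of `S ⧸ J` into its homogeneous components. -/
def quotientDecompose : (S ⧸ J.toIdeal) →+ ⨁ n, quotientGrading 𝒜 J n :=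
  QuotientAddGroup.lift J.toIdeal.toAddSubgroup (quotientDecomposeAux 𝒜 J).toAddMonoidHom
    fun _ hx ↦ quotientDecomposeAux_eq_zero 𝒜 J hx

theorem quotientDecompose_of_mem {n : ℕ} {x : S} (hx : x ∈ 𝒜 n) :
    quotientDecompose 𝒜 J (Ideal.Quotient.mk J.toIdeal x) =
      DirectSum.of (fun n ↦ quotientGrading 𝒜 J n) n
        ⟨Ideal.Quotient.mk J.toIdeal x, Submodule.mem_map_of_mem hx⟩ :=
  quotientDecomposeAux_of_mem 𝒜 J hx

instance quotientGradedAlgebra : GradedAlgebra (quotientGrading 𝒜 J) where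
  one_mem := ⟨1, SetLike.GradedOne.one_mem, map_one (Ideal.Quotient.mk J.toIdeal)⟩
  mul_mem := by
    rintro i j _ _ ⟨x, hx, rfl⟩ ⟨y, hy, rfl⟩
    exact ⟨x * y, SetLike.GradedMul.mul_mem hx hy, map_mul (Ideal.Quotient.mk J.toIdeal) _ _⟩
  decompose' := quotientDecompose 𝒜 J
  left_inv x := by
    classical
    obtain ⟨x, rfl⟩ := Ideal.Quotient.mk_surjective x
    rw [← DirectSum.sum_support_decompose 𝒜 x, map_sum, map_sum, map_sum]
    refine Finset.sum_congr rfl fun n _ ↦ ?_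
    rw [quotientDecompose_of_mem 𝒜 J (SetLike.coe_mem _)]
    exact DirectSum.coeAddMonoidHom_of _ _ _
  right_inv x := by
    induction x using DirectSum.induction_on with
    | zero => simp
    | of n x =>
      obtain ⟨_, x, hx, rfl⟩ := x
      rw [DirectSum.coeAddMonoidHom_of]
      exact quotientDecompose_of_mem 𝒜 J hx
    | add x y hx hy => rw [map_add, map_add, hx, hy]

/-- The quotient map `S → S ⧸ J` as a homomorphism of graded rings. -/
def quotientGradedHom : 𝒜 →+*ᵍ quotientGrading 𝒜 J where
  __ := Ideal.Quotient.mk J.toIdeal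
  map_mem hx := Submodule.mem_map_of_mem hx

theorem irrelevant_le_map_quotientGradedHom :
    HomogeneousIdeal.irrelevant (quotientGrading 𝒜 J) ≤
      (HomogeneousIdeal.irrelevant 𝒜).map (quotientGradedHom 𝒜 J) := by
  rw [HomogeneousIdeal.irrelevant_le]
  rintro i hi _ ⟨x, hx, rfl⟩
  exact Ideal.mem_map_of_mem _ (HomogeneousIdeal.mem_irrelevant_of_mem 𝒜 hi hx)

end Quotient

variable {A : Type u} [CommRing A] (I : Ideal A)

/-- The grading of the Rees algebra `A[It] = ⨁ₙ Iⁿtⁿ ⊆ A[t]` by the degree in `t`. -/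
def reesGrading (n : ℕ) : Submodule A (reesAlgebra I) :=
  (LinearMap.range (monomial n : A →ₗ[A] A[X])).comap (reesAlgebra I).val.toLinearMap

/-- The element `a tⁿ` of the Rees algebra, for `a ∈ Iⁿ`. -/
def reesMonomial (n : ℕ) : ↥(I ^ n) →ₗ[A] reesGrading I n where
  toFun a := ⟨⟨monomial n a.1, reesAlgebra.monomial_mem.mpr a.2⟩, a.1, rfl⟩
  map_add' a b := by ext1; ext1; simp
  map_smul' c a := by ext1; ext1; simp [smul_monomial]

/-- The homogeneous component of degree `n` of an element of the Rees algebra. -/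
def reesComponent (x : reesAlgebra I) (n : ℕ) : reesGrading I n :=
  reesMonomial I n ⟨x.1.coeff n, (mem_reesAlgebra_iff I x.1).mp x.2 n⟩

theorem coe_reesComponent (x : reesAlgebra I) (n : ℕ) :
    ((reesComponent I x n : reesAlgebra I) : A[X]) = monomial n (x.1.coeff n) := rfl

open Classical in
/-- The decomposition of an element of the Rees algebra into its homogeneous components. -/
def reesDecompose (x : reesAlgebra I) : ⨁ n, reesGrading I n :=
  DirectSum.mk _ x.1.support fun n ↦ reesComponent I x n

theorem reesDecompose_apply (x : reesAlgebra I) (n : ℕ) :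
    reesDecompose I x n = reesComponent I x n := by
  classical
  by_cases hn : n ∈ x.1.support
  · exact DirectSum.mk_apply_of_mem hn
  · refine (DirectSum.mk_apply_of_notMem hn).trans ?_
    ext1; ext1
    simp [coe_reesComponent, notMem_support_iff.mp hn]

theorem reesDecompose_coe (n : ℕ) (x : reesGrading I n) :
    reesDecompose I x = DirectSum.of (fun n ↦ reesGrading I n) n x := by
  classical
  obtain ⟨⟨x, hx⟩, a, ha⟩ := x
  change monomial n a = x at ha
  subst ha
  refine DFinsupp.ext fun m ↦ ?_
  rw [reesDecompose_apply]
  ext1; ext1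
  rw [coe_reesComponent]
  by_cases h : n = m
  · subst h
    rw [DirectSum.of_eq_same]
    simp
  · rw [DirectSum.of_eq_of_ne _ _ _ (Ne.symm h)]
    simp [coeff_monomial, h]

theorem reesDecompose_add (x y : reesAlgebra I) :
    reesDecompose I (x + y) = reesDecompose I x + reesDecompose I y := by
  refine DFinsupp.ext fun m ↦ ?_
  rw [DirectSum.add_apply, reesDecompose_apply, reesDecompose_apply, reesDecompose_apply]
  ext1; ext1
  simp [coe_reesComponent]

instance reesGradedAlgebra : GradedAlgebra (reesGrading I) where
  one_mem := ⟨1, rfl⟩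
  mul_mem := by
    rintro i j ⟨x, hx⟩ ⟨y, hy⟩ ⟨a, ha⟩ ⟨b, hb⟩
    change monomial i a = x at ha
    change monomial j b = y at hb
    exact ⟨a * b, by simp [← ha, ← hb, monomial_mul_monomial]⟩
  decompose' := reesDecompose I
  left_inv x := by
    classical
    have hsub : DFinsupp.support (reesDecompose I x) ⊆ x.1.support := by
      intro n hn
      rw [DFinsupp.mem_support_iff, reesDecompose_apply] at hn
      rw [mem_support_iff]
      rintro h
      refine hn ?_
      ext1; ext1
      simp [coe_reesComponent, h]
    rw [DirectSum.coeAddMonoidHom_eq_dfinsuppSum, DFinsupp.sum, Finset.sum_subset hsub]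
    · apply Subtype.ext
      conv_rhs => rw [x.1.as_sum_support]
      rw [AddSubmonoidClass.coe_finsetSum]
      exact Finset.sum_congr rfl fun n _ ↦ by rw [reesDecompose_apply, coe_reesComponent]
    · intro n _ hn
      rw [DFinsupp.notMem_support_iff.mp hn]
      rfl
  right_inv x := by
    induction x using DirectSum.induction_on with
    | zero =>
      refine DFinsupp.ext fun m ↦ ?_
      rw [map_zero, reesDecompose_apply]
      ext1; ext1
      simp [coe_reesComponent]
    | of n x =>
      rw [DirectSum.coeAddMonoidHom_of, reesDecompose_coe]
    | add x y hx hy =>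
      rw [map_add, reesDecompose_add, hx, hy]

/-- The blow-up `Proj (A[It])` of `Spec A` with centre `I`. -/
def blowup : Scheme.{u} := Proj (reesGrading I)

/-- The structure morphism `Proj (A[It]) ⟶ Spec A` of the blow-up. -/
def blowupπ : blowup I ⟶ Spec (.of A) :=
  Proj.toSpecZero (reesGrading I) ≫ Spec.map (CommRingCat.ofHom (algebraMap A (reesGrading I 0)))

variable {I} {f : A} (hf : f ∈ I)

/-- The degree one element `ft` of the Rees algebra `A[It]`, for `f ∈ I`. -/
def reesT : reesAlgebra I :=
  ⟨monomial 1 f, reesAlgebra.monomial_mem.mpr (by rwa [pow_one])⟩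

/-- The homogeneous ideal of `A[It]` generated by `ft`. -/
def reesTIdeal : HomogeneousIdeal (reesGrading I) where
  toSubmodule := Ideal.span {reesT hf}
  is_homogeneous' := Ideal.homogeneous_span _ _ <| by
    rintro _ rfl
    exact ⟨1, f, rfl⟩

/-- The proper transform `Proj (A[It] / ft)` of `div f`. -/
def properTransform : Scheme.{u} := Proj (quotientGrading (reesGrading I) (reesTIdeal hf))

/-- The canonical morphism from the proper transform to the blow-up. -/
def properTransformι : properTransform hf ⟶ blowup I :=
  Proj.map (quotientGradedHom (reesGrading I) (reesTIdeal hf))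
    (irrelevant_le_map_quotientGradedHom _ _)

variable (I f)

/-- The closed immersion of `D = div f = Spec (A / f)` in `Spec A`. -/
def divι : Spec (.of (A ⧸ Ideal.span {f})) ⟶ Spec (.of A) :=
  Spec.map (CommRingCat.ofHom (Ideal.Quotient.mk (Ideal.span {f})))

/-- The open subset `Spec A \ V(I)` of `Spec A`. -/
def centreCompl : (Spec (.of A)).Opens :=
  ⟨(PrimeSpectrum.zeroLocus (I : Set A))ᶜ, (PrimeSpectrum.isClosed_zeroLocus _).isOpen_compl⟩

/-- The immersion in `Spec A` of the open subscheme `D \ V(I)` of `D = div f`. -/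
def divComplι : ((divι f) ⁻¹ᵁ (centreCompl I)).toScheme ⟶ Spec (.of A) :=
  ((divι f) ⁻¹ᵁ (centreCompl I)).ι ≫ divι f

/-- The strict transform of `D = div f`: the schematic closure in the blow-up of the
inverse image of `D \ V(I)`. -/
def strictTransform : Scheme.{u} :=
  (pullback.fst (blowupπ I) (divComplι I f)).image

/-- The inclusion of the strict transform in the blow-up. -/
def strictTransformι : strictTransform I f ⟶ blowup I :=
  (pullback.fst (blowupπ I) (divComplι I f)).imageι

end AffineModification

end

/-! ### Powers of an ideal generated by a regular sequence -/

section QuasiRegular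

open Ideal RingTheory.Sequence

variable {A : Type*} [CommRing A]

/-! Both transforms are closed subschemes of the blow-up, so it is enough to compare their ideal
sheaves, chart by chart. Let `B` be the degree zero part of `A[It]` localized at `at`, where `a` is
one of the generators of `I`. In `B` one has `IB = aB` and `f = a · (f/a)`. The proper transform is
cut out by `f/a`, while the inverse image of `D \ V(I)` is the spectrum of `B[1/a]/(f) =
B[1/a]/(f/a)`. Hence the strict transform corresponds to the kernel of `B → B[1/a]/(f/a)`, and the
two agree as soon as `a` is a nonzerodivisor on `B/(f/a)`.

That regularity follows from a single algebraic fact: `f x ∈ I ^ (m + 1)` implies `x ∈ I ^ m`, i.e.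
the initial form of `f` is regular in the associated graded ring of `I` (`mem_ofList_cons_pow`). It
is proved by removing the last element of the sequence, keeping an auxiliary ideal `K ⊇ I` fixed
while the list shrinks. `properTransformAwayMap_eq_zero_of_mul` carries it to the charts;
`ker_properTransformι_le` and `le_ker_properTransformι` are the two inclusions of ideal sheaves, and
only the second uses regularity. -/

theorem Ideal.sup_span_singleton_pow_succ_le (J : Ideal A) (b : A) (m : ℕ) :
    (J ⊔ span {b}) ^ (m + 1) ≤ J ^ (m + 1) ⊔ span {b} * (J ⊔ span {b}) ^ m := by
  induction m with
  | zero => simp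
  | succ m ih =>
    conv_lhs => rw [pow_succ', sup_mul]
    refine sup_le ?_ le_sup_right
    refine (Ideal.mul_mono_right ih).trans ?_
    rw [Ideal.mul_sup, ← pow_succ', mul_left_comm]
    refine sup_le_sup_left (Ideal.mul_mono_right ?_) _
    rw [pow_succ']
    exact Ideal.mul_mono_left le_sup_left

theorem Ideal.exists_add_of_mem_mul_sup_span_singleton_pow_succ {K J : Ideal A} {b : A} {m : ℕ}
    {x : A} (hx : x ∈ K * (J ⊔ span {b}) ^ (m + 1)) :
    ∃ y ∈ K * J ^ (m + 1), ∃ z ∈ K * (J ⊔ span {b}) ^ m, x = y + b * z := by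
  have := Ideal.mul_mono_right (I := K) (sup_span_singleton_pow_succ_le J b m) hx
  rw [Ideal.mul_sup, mul_left_comm, Submodule.mem_sup] at this
  obtain ⟨y, hy, w, hw, hyw⟩ := this
  obtain ⟨z, hz, hzw⟩ := mem_span_singleton_mul.mp hw
  exact ⟨y, hy, z, hz, by rw [hzw, hyw]⟩

theorem Ideal.exists_add_of_mem_sup_span_singleton_pow_succ {J : Ideal A} {b : A} {m : ℕ}
    {x : A} (hx : x ∈ (J ⊔ span {b}) ^ (m + 1)) :
    ∃ y ∈ J ^ (m + 1), ∃ z ∈ (J ⊔ span {b}) ^ m, x = y + b * z := by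
  rw [← one_mul ((J ⊔ span {b}) ^ (m + 1))] at hx
  simpa using exists_add_of_mem_mul_sup_span_singleton_pow_succ hx

theorem Ideal.ofList_concat (l : List A) (b : A) : ofList (l ++ [b]) = ofList l ⊔ span {b} := by
  simp

theorem RingTheory.Sequence.IsWeaklyRegular.of_concat {l : List A} {b : A}
    (h : IsWeaklyRegular A (l ++ [b])) :
    IsWeaklyRegular A l ∧ ∀ x, b * x ∈ ofList l → x ∈ ofList l := by
  refine ⟨⟨fun i hi ↦ ?_⟩, fun x hx ↦ ?_⟩
  · have := h.regular_mod_prev i (by simp; omega)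
    rwa [List.getElem_append_left hi, List.take_append_of_le_length hi.le] at this
  · have := h.regular_mod_prev l.length (by simp)
    rw [List.take_left, List.getElem_concat_length rfl] at this
    have h0 := (isSMulRegular_iff_right_eq_zero_of_smul.mp this)
      (Submodule.Quotient.mk x) (by
        rw [← Submodule.Quotient.mk_smul, Submodule.Quotient.mk_eq_zero]; simpa using hx)
    simpa using (Submodule.Quotient.mk_eq_zero _).mp h0

/-- An element which is regular modulo `K` is regular on `Jᵐ / K Jᵐ`, where `J ≤ K` is generated by
a weakly regular sequence. -/
theorem RingTheory.Sequence.IsWeaklyRegular.mem_mul_ofList_pow {l : List A}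
    (hl : IsWeaklyRegular A l) {K : Ideal A} (hK : ofList l ≤ K) {c : A}
    (hc : ∀ x, c * x ∈ K → x ∈ K) {m : ℕ} {p : A} (hp : p ∈ ofList l ^ m)
    (hcp : c * p ∈ K * ofList l ^ m) : p ∈ K * ofList l ^ m := by
  induction l using List.reverseRecOn generalizing K c m p with
  | nil =>
    cases m with
    | zero => simpa using hc p (by simpa using hcp)
    | succ m =>
      obtain rfl : p = 0 := by simpa [pow_succ] using hp
      exact zero_mem _
  | append_singleton l b ih =>
    obtain ⟨hl, hb⟩ := hl.of_concat
    rw [ofList_concat] at hK hp hcp ⊢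
    set J := ofList l with hJ
    have hJK : J ≤ K := le_sup_left.trans hK
    have hbK : b ∈ K := hK (le_sup_right (a := J) (mem_span_singleton_self b))
    -- The induction hypothesis for the shorter list, taken with `K = J` and `c = b`, shows that `b`
    -- is regular modulo every power of `J`.
    have hbp : ∀ m x, b * x ∈ J ^ m → x ∈ J ^ m := by
      intro m
      induction m with
      | zero => simp
      | succ m ihm =>
        intro x hx
        rw [pow_succ'] at hx ⊢
        exact ih hl le_rfl hb (ihm x (Ideal.mul_le_right hx)) hx
    induction m generalizing p with
    | zero => simpa using hc p (by simpa using hcp)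
    | succ m ihm =>
      obtain ⟨p', hp', w, hw, rfl⟩ := exists_add_of_mem_sup_span_singleton_pow_succ hp
      obtain ⟨k, hk, k', hk', h⟩ := exists_add_of_mem_mul_sup_span_singleton_pow_succ hcp
      -- Comparing the two expansions `c (p' + b w) = k + b k'` puts `b (k' - c w)` in `J ^ (m +
      -- 1)`, and `b` can be cancelled. The difference is then small enough to be absorbed in both
      -- coefficients: `w` is handled by induction on `m`, `p'` by induction on the list.
      have h1 : k' - c * w ∈ J ^ (m + 1) := by
        refine hbp _ _ ?_
        rw [show b * (k' - c * w) = c * p' - k by linear_combination -h]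
        exact sub_mem (mul_mem_left _ _ hp') (Ideal.mul_le_right hk)
      have h2 : J ^ (m + 1) ≤ K * (J ⊔ span {b}) ^ m := by
        rw [pow_succ']
        exact Ideal.mul_mono hJK (Ideal.pow_right_mono le_sup_left m)
      have h3 : w ∈ K * (J ⊔ span {b}) ^ m := by
        refine ihm hw ?_
        rw [show c * w = k' - (k' - c * w) by ring]
        exact sub_mem hk' (h2 h1)
      have h4 : p' ∈ K * J ^ (m + 1) := by
        refine ih hl hJK hc hp' ?_
        rw [show c * p' = k + b * (k' - c * w) by linear_combination h]
        exact add_mem hk (Ideal.mul_mem_mul hbK h1)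
      refine add_mem (Ideal.mul_mono_right (Ideal.pow_right_mono le_sup_left _) h4) ?_
      rw [pow_succ', mul_left_comm]
      exact Ideal.mul_mem_mul (le_sup_right (a := J) (mem_span_singleton_self b)) h3

/-- An element which is regular modulo an ideal generated by a weakly regular sequence is regular
modulo the powers of this ideal. -/
theorem RingTheory.Sequence.IsWeaklyRegular.mem_ofList_pow {l : List A}
    (hl : IsWeaklyRegular A l) {c : A} (hc : ∀ x, c * x ∈ ofList l → x ∈ ofList l) (m : ℕ) {x : A}
    (hx : c * x ∈ ofList l ^ m) : x ∈ ofList l ^ m := by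
  induction m with
  | zero => simp
  | succ m ih =>
    rw [pow_succ'] at hx ⊢
    exact hl.mem_mul_ofList_pow le_rfl hc (ih (Ideal.mul_le_right hx)) hx

/-- Heuristically, the sum of the `Jᵐ / K Jᵐ` is a polynomial ring over `A / K` in which `f` is one
of the variables. The argument is that of `mem_mul_ofList_pow` with the degree shifted by one; `K`
is independent of the list so that it survives the removal of the last element. -/
theorem RingTheory.Sequence.IsWeaklyRegular.mem_mul_ofList_cons_pow {f : A} {l : List A}
    (hl : IsWeaklyRegular A (f :: l)) {K : Ideal A} (hK : ofList (f :: l) ≤ K) {m : ℕ} {p : A}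
    (hp : p ∈ ofList (f :: l) ^ m) (hfp : f * p ∈ K * ofList (f :: l) ^ (m + 1)) :
    p ∈ K * ofList (f :: l) ^ m := by
  induction l using List.reverseRecOn generalizing K m p with
  | nil =>
    have hf : ∀ x, f * x = 0 → x = 0 := by
      simpa using (RingTheory.Sequence.IsWeaklyRegular.of_concat (l := []) hl).2
    simp only [ofList_singleton] at hp hfp ⊢
    rw [pow_succ', mul_left_comm, mem_span_singleton_mul] at hfp
    obtain ⟨z, hz, h⟩ := hfp
    rwa [← sub_eq_zero.mp (hf (z - p) (by linear_combination h))]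
  | append_singleton l b ih =>
    rw [← List.cons_append] at hl hK hp hfp ⊢
    obtain ⟨hl, hb⟩ := hl.of_concat
    rw [ofList_concat] at hK hp hfp ⊢
    have hfJ : f ∈ ofList (f :: l) := Ideal.subset_span (by simp)
    have hbp := fun m x ↦ hl.mem_ofList_pow hb m (x := x)
    specialize @ih hl
    set J := ofList (f :: l) with hJ
    have hJK : J ≤ K := le_sup_left.trans hK
    have hbK : b ∈ K := hK (le_sup_right (a := J) (mem_span_singleton_self b))
    induction m generalizing p with
    -- Here `p` is arbitrary and has no expansion in `b`. Instead `k' ∈ J`, because `b` is regular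
    -- modulo `J`; then `f p ∈ K J` since `b ∈ K`, and the shorter list applies.
    | zero =>
      obtain ⟨k, hk, k', hk', h⟩ := exists_add_of_mem_mul_sup_span_singleton_pow_succ hfp
      have h1 : k' ∈ J := by
        refine hb _ ?_
        rw [show b * k' = f * p - k by linear_combination -h]
        exact sub_mem (mul_mem_right _ _ hfJ) (by simpa using Ideal.mul_le_right hk)
      have := ih hJK (m := 0) (p := p) (by simp) (by
        rw [h]
        exact add_mem hk (Ideal.mul_mem_mul hbK (by simpa using h1)))
      simpa using this
    | succ m ihm =>
      obtain ⟨p', hp', w, hw, rfl⟩ := exists_add_of_mem_sup_span_singleton_pow_succ hp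
      obtain ⟨k, hk, k', hk', h⟩ := exists_add_of_mem_mul_sup_span_singleton_pow_succ hfp
      have h1 : k' - f * w ∈ J ^ (m + 2) := by
        refine hbp _ _ ?_
        rw [show b * (k' - f * w) = f * p' - k by linear_combination -h]
        refine sub_mem ?_ (Ideal.mul_le_right hk)
        rw [pow_succ']
        exact Ideal.mul_mem_mul hfJ hp'
      have h2 : J ^ (m + 2) ≤ K * (J ⊔ span {b}) ^ (m + 1) := by
        rw [pow_succ']
        exact Ideal.mul_mono hJK (Ideal.pow_right_mono le_sup_left _)
      have h3 : w ∈ K * (J ⊔ span {b}) ^ m := by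
        refine ihm hw ?_
        rw [show f * w = k' - (k' - f * w) by ring]
        exact sub_mem hk' (h2 h1)
      have h4 : p' ∈ K * J ^ (m + 1) := by
        refine ih hJK hp' ?_
        rw [show f * p' = k + b * (k' - f * w) by linear_combination h]
        exact add_mem hk (Ideal.mul_mem_mul hbK h1)
      refine add_mem (Ideal.mul_mono_right (Ideal.pow_right_mono le_sup_left _) h4) ?_
      rw [pow_succ', mul_left_comm]
      exact Ideal.mul_mem_mul (le_sup_right (a := J) (mem_span_singleton_self b)) h3

/-- The initial form of the first element of a weakly regular sequence is regular in the associated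
graded ring of the ideal generated by the sequence. -/
theorem RingTheory.Sequence.IsWeaklyRegular.mem_ofList_cons_pow {f : A} {l : List A}
    (hl : IsWeaklyRegular A (f :: l)) (m : ℕ) {x : A}
    (hx : f * x ∈ ofList (f :: l) ^ (m + 1)) : x ∈ ofList (f :: l) ^ m := by
  induction m with
  | zero => simp
  | succ m ih =>
    rw [pow_succ'] at hx ⊢
    exact hl.mem_mul_ofList_cons_pow le_rfl (ih (Ideal.mul_le_right hx)) hx

end QuasiRegular

/-! ### Homogeneous elements and ideals of the Rees algebra -/

noncomputable section

namespace AffineModification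

open HomogeneousLocalization

variable {A : Type u} [CommRing A] {I : Ideal A}

theorem reesT_mem {f : A} (hf : f ∈ I) : reesT hf ∈ reesGrading I 1 := ⟨f, rfl⟩

theorem exists_reesMonomial_eq {n : ℕ} {x : reesAlgebra I} (hx : x ∈ reesGrading I n) :
    ∃ c, ∃ hc : c ∈ I ^ n, (reesMonomial I n ⟨c, hc⟩ : reesAlgebra I) = x := by
  obtain ⟨x, h⟩ := x
  obtain ⟨c, hc⟩ := hx
  change monomial n c = x at hc
  subst hc
  exact ⟨c, reesAlgebra.monomial_mem.mp h, rfl⟩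

/-- Since `I ^ (n + 1) = I ^ n * I`, every element of positive degree is a combination of the `aᵢt`.
This is what makes the charts `D₊(aᵢt)` cover the blow-up. -/
theorem irrelevant_le_span_reesT {ι : Type*} (a : ι → A) (ha : ∀ i, a i ∈ I)
    (hI : I ≤ Ideal.span (Set.range a)) :
    (HomogeneousIdeal.irrelevant (reesGrading I)).toIdeal ≤
      Ideal.span (Set.range fun i ↦ reesT (ha i)) := by
  rw [HomogeneousIdeal.toIdeal_irrelevant_le]
  rintro (_ | n) hn x hx
  · exact absurd hn (lt_irrefl 0)
  obtain ⟨c, hc, rfl⟩ := exists_reesMonomial_eq hx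
  suffices H : ∀ c (hc : c ∈ I ^ n * I), (reesMonomial I (n + 1) ⟨c, by rwa [pow_succ]⟩ :
      reesAlgebra I) ∈ Ideal.span (Set.range fun i ↦ reesT (ha i)) from H c (by rwa [← pow_succ])
  have hI' : Ideal.span (Set.range a) ≤ I := Ideal.span_le.mpr (by rintro _ ⟨i, rfl⟩; exact ha i)
  intro c hc
  induction hc using Submodule.mul_induction_on' with
  | add x hx y hy h1 h2 =>
    convert add_mem h1 h2 using 1
    ext1; exact map_add _ _ _
  | mem_mul_mem x hx y hy =>
    have key : ∀ y ∈ Ideal.span (Set.range a), ∀ h : y ∈ I,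
        reesT h ∈ Ideal.span (Set.range fun i ↦ reesT (ha i)) := by
      intro y hy h
      induction hy using Submodule.span_induction with
      | mem y hy =>
        obtain ⟨i, rfl⟩ := hy
        exact Ideal.subset_span ⟨i, rfl⟩
      | zero =>
        have : reesT h = 0 := by ext1; exact map_zero _
        rw [this]
        exact zero_mem _
      | add y z hy hz h1 h2 =>
        convert add_mem (h1 (hI' hy)) (h2 (hI' hz))
        ext1; exact map_add _ _ _
      | smul r y hy h1 =>
        convert Ideal.mul_mem_left _ (algebraMap A _ r) (h1 (hI' hy))
        ext1
        simp [reesT, C_mul_monomial]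
    convert Ideal.mul_mem_left _ (reesMonomial I n ⟨x, hx⟩ : reesAlgebra I) (key y (hI hy) hy)
    ext1
    exact (monomial_mul_monomial _ _ _ _).symm

theorem reesMonomial_mem_reesTIdeal {f : A} (hf : f ∈ I) {m : ℕ} {c : A} {hc : c ∈ I ^ (m + 1)} :
    (reesMonomial I (m + 1) ⟨c, hc⟩ : reesAlgebra I) ∈ (reesTIdeal hf).toIdeal ↔
      ∃ d ∈ I ^ m, c = f * d := by
  change _ ∈ Ideal.span {reesT hf} ↔ _
  rw [Ideal.mem_span_singleton']
  constructor
  · rintro ⟨y, hy⟩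
    refine ⟨y.1.coeff m, (mem_reesAlgebra_iff I y.1).mp y.2 m, ?_⟩
    have := congr_arg (fun z : reesAlgebra I ↦ z.1.coeff (m + 1)) hy
    simp only [reesT, reesMonomial] at this
    simpa [coeff_mul_monomial, mul_comm] using this.symm
  · rintro ⟨d, hd, rfl⟩
    refine ⟨reesMonomial I m ⟨d, hd⟩, ?_⟩
    ext1
    refine (monomial_mul_monomial _ _ _ _).trans ?_
    rw [mul_comm]; rfl

/-! ### The coordinate rings of the charts -/

section Chart

variable {a : A} (ha : a ∈ I)

/-- The fraction `ctⁿ / (at)ⁿ` in the degree zero part of `A[It]_{at}`, for `c ∈ Iⁿ`. -/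
def reesFraction (n : ℕ) (c : A) (hc : c ∈ I ^ n) : Away (reesGrading I) (reesT ha) :=
  Away.mk (reesGrading I) (reesT_mem ha) n (reesMonomial I n ⟨c, hc⟩)
    (by rw [smul_eq_mul, mul_one]; exact SetLike.coe_mem _)

theorem exists_reesFraction_eq (x : Away (reesGrading I) (reesT ha)) :
    ∃ n c hc, reesFraction ha n c hc = x := by
  obtain ⟨n, y, hy, rfl⟩ := Away.mk_surjective _ (reesT_mem ha) x
  obtain ⟨c, hc, rfl⟩ := exists_reesMonomial_eq (by rwa [smul_eq_mul, mul_one] at hy)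
  exact ⟨n, c, hc, rfl⟩

theorem reesMonomial_mul_reesMonomial {m n : ℕ} {c d : A} (hc : c ∈ I ^ m) (hd : d ∈ I ^ n) :
    (reesMonomial I m ⟨c, hc⟩ * reesMonomial I n ⟨d, hd⟩ : reesAlgebra I) =
      reesMonomial I (m + n) ⟨c * d, by rw [pow_add]; exact Ideal.mul_mem_mul hc hd⟩ := by
  ext1
  exact monomial_mul_monomial _ _ _ _

theorem reesT_pow (k : ℕ) :
    reesT ha ^ k = reesMonomial I k ⟨a ^ k, Ideal.pow_mem_pow ha k⟩ := by
  ext1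
  exact (monomial_pow _ _ _).trans (by rw [one_mul]; rfl)

theorem reesFraction_mul {m n : ℕ} {c d : A} (hc : c ∈ I ^ m) (hd : d ∈ I ^ n) :
    reesFraction ha m c hc * reesFraction ha n d hd =
      reesFraction ha (m + n) (c * d) (by rw [pow_add]; exact Ideal.mul_mem_mul hc hd) := by
  apply val_injective
  rw [val_mul, reesFraction, reesFraction, reesFraction, Away.val_mk, Away.val_mk, Away.val_mk,
    Localization.mk_mul, reesMonomial_mul_reesMonomial]
  congr 1
  exact Subtype.ext (pow_add _ _ _).symm

theorem reesFraction_pow_mul {n : ℕ} {c : A} (hc : c ∈ I ^ n) (k : ℕ) :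
    reesFraction ha (k + n) (a ^ k * c)
        (by rw [pow_add]; exact Ideal.mul_mem_mul (Ideal.pow_mem_pow ha k) hc) =
      reesFraction ha n c hc := by
  apply val_injective
  rw [reesFraction, reesFraction, Away.val_mk, Away.val_mk, Localization.mk_eq_mk_iff,
    Localization.r_iff_exists]
  refine ⟨1, ?_⟩
  simp only [OneMemClass.coe_one, one_mul]
  rw [← reesMonomial_mul_reesMonomial (Ideal.pow_mem_pow ha k) hc, ← reesT_pow ha]
  ring

/-- The structure map from `A` to the degree zero part of `A[It]_{at}`. -/
def awayAlgebraMap : A →+* Away (reesGrading I) (reesT ha) :=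
  (fromZeroRingHom (reesGrading I) _).comp (algebraMap A (reesGrading I 0))

theorem awayAlgebraMap_apply (c : A) :
    awayAlgebraMap ha c = reesFraction ha 0 c (by simp) := by
  apply val_injective
  rw [reesFraction, Away.val_mk]
  change Localization.mk _ _ = _
  congr 1

/-- The identity `c = a · (c/a)`: on the chart, `I` generates the principal ideal `(a)`. -/
theorem awayAlgebraMap_of_mem {c : A} (hc : c ∈ I) :
    awayAlgebraMap ha c =
      awayAlgebraMap ha a * reesFraction ha 1 c (by rwa [pow_one]) := by
  rw [awayAlgebraMap_apply, awayAlgebraMap_apply, reesFraction_mul,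
    ← reesFraction_pow_mul ha (n := 0) (c := c) (by simp) 1]
  simp

variable {f : A} (hf : f ∈ I)

/-- The restriction of sections over the chart `D₊(at)` to the proper transform of `div f`. -/
abbrev properTransformAwayMap : Away (reesGrading I) (reesT ha) →+*
    Away (quotientGrading (reesGrading I) (reesTIdeal hf))
      (quotientGradedHom (reesGrading I) (reesTIdeal hf) (reesT ha)) :=
  Away.map (quotientGradedHom (reesGrading I) (reesTIdeal hf)) (reesT ha)

theorem quotientGradedHom_awayMap_surjective {R S : Type u} [CommRing R] [CommRing S] [Algebra R S]
    (𝒜 : ℕ → Submodule R S) [GradedAlgebra 𝒜] (J : HomogeneousIdeal 𝒜) {d : ℕ} {s : S}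
    (hs : s ∈ 𝒜 d) : Function.Surjective (Away.map (quotientGradedHom 𝒜 J) s) := by
  intro x
  obtain ⟨n, y, hy, rfl⟩ := Away.mk_surjective _ ((quotientGradedHom 𝒜 J).map_mem hs) x
  obtain ⟨z, hz, rfl⟩ := hy
  exact ⟨Away.mk 𝒜 hs n z hz, Away.map_mk ..⟩

/-- A fraction vanishes when its numerator, multiplied by a power of `at`, falls in the ideal
`(ft)`. Using the exponent `k + 1` costs nothing and makes the degree `n + k + 1` positive, so that
the cofactor of `ft` has degree `n + k`. -/
theorem properTransformAwayMap_reesFraction_eq_zero_iff {n : ℕ} {c : A} (hc : c ∈ I ^ n) :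
    properTransformAwayMap ha hf (reesFraction ha n c hc) = 0 ↔
      ∃ k, ∃ d ∈ I ^ (n + k), a ^ (k + 1) * c = f * d := by
  have key : ∀ k, quotientGradedHom (reesGrading I) (reesTIdeal hf) (reesT ha) ^ (k + 1) *
      quotientGradedHom (reesGrading I) (reesTIdeal hf) (reesMonomial I n ⟨c, hc⟩) = 0 ↔
      ∃ d ∈ I ^ (n + k), a ^ (k + 1) * c = f * d := by
    intro k
    rw [← map_pow, ← map_mul]
    refine Ideal.Quotient.eq_zero_iff_mem.trans ?_
    have h : a ^ (k + 1) * c ∈ I ^ (n + k + 1) := by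
      rw [add_assoc, add_comm n, pow_add]
      exact Ideal.mul_mem_mul (Ideal.pow_mem_pow ha _) hc
    rw [← reesMonomial_mem_reesTIdeal hf (hc := h), reesT_pow, reesMonomial_mul_reesMonomial]
    have e : ∀ {i j : ℕ} (_ : i = j) {b : A} (hi : b ∈ I ^ i) (hj : b ∈ I ^ j),
        (reesMonomial I i ⟨b, hi⟩ : reesAlgebra I) = reesMonomial I j ⟨b, hj⟩ := by
      rintro i _ rfl b _ _; rfl
    rw [e (by omega) _ h]
  rw [reesFraction, properTransformAwayMap, Away.map_mk, ← (val_injective _).eq_iff, Away.val_mk,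
    val_zero, ← Localization.mk_zero 1, Localization.mk_eq_mk_iff, Localization.r_iff_exists]
  constructor
  · rintro ⟨⟨_, k, rfl⟩, h⟩
    refine ⟨k, (key k).mp ?_⟩
    simp at h
    rw [pow_succ', mul_assoc, h, mul_zero]
  · rintro ⟨k, h⟩
    refine ⟨⟨_, k + 1, rfl⟩, ?_⟩
    simpa using (key k).mpr h

theorem exists_eq_mul_of_properTransformAwayMap_eq_zero {x : Away (reesGrading I) (reesT ha)}
    (hx : properTransformAwayMap ha hf x = 0) :
    ∃ y, x = reesFraction ha 1 f (by rwa [pow_one]) * y := by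
  obtain ⟨n, c, hc, rfl⟩ := exists_reesFraction_eq ha x
  obtain ⟨k, d, hd, h⟩ := (properTransformAwayMap_reesFraction_eq_zero_iff ha hf hc).mp hx
  refine ⟨reesFraction ha (n + k) d hd, ?_⟩
  rw [reesFraction_mul, ← reesFraction_pow_mul ha hc (k + 1)]
  simp only [h]
  congr 1
  omega

theorem properTransformAwayMap_reesFraction_self :
    properTransformAwayMap ha hf (reesFraction ha 1 f (by rwa [pow_one])) = 0 :=
  (properTransformAwayMap_reesFraction_eq_zero_iff ha hf _).mpr ⟨0, a, by simpa, by ring⟩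

/-- This is the regularity of `a` on `B/(f/a)`, the only place where the cancellation property of
`f` does its work. -/
theorem properTransformAwayMap_eq_zero_of_mul (hI : ∀ m x, f * x ∈ I ^ (m + 1) → x ∈ I ^ m)
    {x : Away (reesGrading I) (reesT ha)}
    (hx : properTransformAwayMap ha hf (awayAlgebraMap ha a * x) = 0) :
    properTransformAwayMap ha hf x = 0 := by
  obtain ⟨n, c, hc, rfl⟩ := exists_reesFraction_eq ha x
  rw [awayAlgebraMap_apply, reesFraction_mul, properTransformAwayMap_reesFraction_eq_zero_iff] at hx
  obtain ⟨k, d, hd, h⟩ := hx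
  -- The same `d` serves: `f d = a ^ (k + 2) c` lies one power of `I` deeper than `d ∈ I ^ (n + k)`
  -- would give, so `hI` improves `d` to `I ^ (n + k + 1)`.
  refine (properTransformAwayMap_reesFraction_eq_zero_iff ha hf hc).mpr
    ⟨k + 1, d, hI _ _ ?_, by rw [← h]; ring⟩
  rw [← h, ← mul_assoc, ← pow_succ, add_comm n, add_right_comm, pow_add]
  exact Ideal.mul_mem_mul (Ideal.pow_mem_pow ha _) hc

end Chart

/-! ### Proj of a graded quotient is a closed subscheme -/

section ClosedImmersion

variable {R S : Type u} [CommRing R] [CommRing S] [Algebra R S]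
  (𝒜 : ℕ → Submodule R S) [GradedAlgebra 𝒜] (J : HomogeneousIdeal 𝒜)

instance isClosedImmersion_map_quotientGradedHom :
    IsClosedImmersion (Proj.map (quotientGradedHom 𝒜 J)
      (irrelevant_le_map_quotientGradedHom 𝒜 J)) := by
  set ι := Proj.map (quotientGradedHom 𝒜 J) (irrelevant_le_map_quotientGradedHom 𝒜 J)
  -- Over `D₊(s)` the map is, up to isomorphism, the spectrum of a surjection of degree zero
  -- localizations.
  have key {i : ℕ} (hi : 0 < i) (s : S) (hs : s ∈ 𝒜 i) :
      IsClosedImmersion (ι ∣_ Proj.basicOpen 𝒜 s) := by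
    have h := Proj.awayι_comp_map (quotientGradedHom 𝒜 J)
      (irrelevant_le_map_quotientGradedHom 𝒜 J) hi s hs
    have := IsClosedImmersion.spec_of_surjective
      (CommRingCat.ofHom (Away.map (quotientGradedHom 𝒜 J) s))
      (quotientGradedHom_awayMap_surjective 𝒜 J hs)
    let e := Scheme.isoOfEq _ (Proj.map_preimage_basicOpen (quotientGradedHom 𝒜 J)
        (irrelevant_le_map_quotientGradedHom 𝒜 J) s) ≪≫
      Proj.basicOpenIsoSpec (quotientGrading 𝒜 J) (quotientGradedHom 𝒜 J s)
        ((quotientGradedHom 𝒜 J).map_mem hs) hi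
    have key : ι ∣_ Proj.basicOpen 𝒜 s = e.hom ≫
        Spec.map (CommRingCat.ofHom (Away.map (quotientGradedHom 𝒜 J) s)) ≫
        (Proj.basicOpenIsoSpec 𝒜 s hs hi).inv := by
      rw [← cancel_mono (Proj.basicOpen 𝒜 s).ι, morphismRestrict_ι, Category.assoc, Category.assoc,
        Proj.basicOpenIsoSpec_inv_ι, ← h, Proj.awayι, Category.assoc, Iso.trans_hom, Category.assoc,
        Iso.hom_inv_id_assoc, Scheme.isoOfEq_hom_ι_assoc]
    rw [key]
    infer_instance
  refine IsZariskiLocalAtTarget.of_iSup_eq_top (P := @IsClosedImmersion)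
    (fun s : Σ i : PNat, 𝒜 i ↦ Proj.basicOpen 𝒜 (s.2 : S)) ?_ fun s ↦ key s.1.2 _ s.2.2
  refine Proj.iSup_basicOpen_eq_top 𝒜 _ ?_
  rw [HomogeneousIdeal.toIdeal_irrelevant_le]
  exact fun i hi x hx ↦ Ideal.subset_span ⟨⟨⟨i, hi⟩, ⟨x, hx⟩⟩, rfl⟩

end ClosedImmersion

instance isClosedImmersion_properTransformι {f : A} (hf : f ∈ I) :
    IsClosedImmersion (properTransformι hf) :=
  isClosedImmersion_map_quotientGradedHom _ _

/-! ### Morphisms to the charts and to `D \ V(I)` -/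

theorem awayι_blowupπ {a : A} (ha : a ∈ I) :
    Proj.awayι (reesGrading I) (reesT ha) (reesT_mem ha) one_pos ≫ blowupπ I =
      Spec.map (CommRingCat.ofHom (awayAlgebraMap ha)) := by
  refine (Proj.awayι_toSpecZero_assoc (reesGrading I) _ (reesT_mem ha) one_pos _).trans ?_
  exact (Spec.map_comp _ _).symm

theorem isCompact_centreCompl (hI : I.FG) : IsCompact (centreCompl I : Set (Spec (.of A))) := by
  obtain ⟨s, rfl⟩ := hI
  refine (PrimeSpectrum.isCompact_isOpen_iff.mpr ⟨s, ?_⟩).1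
  change _ = (PrimeSpectrum.zeroLocus _)ᶜ
  rw [PrimeSpectrum.zeroLocus_span]

/-- Quasi-compactness allows the kernel ideal sheaf to be computed on an open cover of the source,
and its support to be the closure of the image. -/
theorem quasiCompact_divComplι (hI : I.FG) (f : A) : QuasiCompact (divComplι I f) := by
  have : CompactSpace ((divι f) ⁻¹ᵁ (centreCompl I)).toScheme :=
    isCompact_iff_compactSpace.mp ((divι f).isCompact_preimage (isCompact_centreCompl hI))
  infer_instance

theorem range_divComplι (f : A) : Set.range (divComplι I f) =
    PrimeSpectrum.zeroLocus {f} \ PrimeSpectrum.zeroLocus (I : Set A) := by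
  have h : Set.range (divι f) = PrimeSpectrum.zeroLocus {f} := by
    refine (range_comap_of_surjective _ (Ideal.Quotient.mk (Ideal.span {f}))
      Ideal.Quotient.mk_surjective).trans ?_
    rw [Ideal.mk_ker]
    exact PrimeSpectrum.zeroLocus_span _
  rw [divComplι, Scheme.Hom.comp_base, TopCat.coe_comp, Set.range_comp, Scheme.Opens.range_ι]
  refine (Set.image_preimage_eq_range_inter (f := divι f) (t := centreCompl I)).trans ?_
  rw [h]; rfl

/-- Over a ring where `f` vanishes and an element of `I` is invertible, a morphism to `Spec A`
factors through `div f \ V(I)`. -/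
theorem exists_comp_divComplι_eq {R : Type u} [CommRing R] (φ : A →+* R) {f a : A}
    (ha : a ∈ I) (hf : φ f = 0) (hu : IsUnit (φ a)) :
    ∃ g, g ≫ divComplι I f = Spec.map (CommRingCat.ofHom φ) := by
  let φ' : A ⧸ Ideal.span {f} →+* R := Ideal.Quotient.lift _ φ fun x hx ↦ by
    obtain ⟨y, rfl⟩ := Ideal.mem_span_singleton'.mp hx
    rw [map_mul, hf, mul_zero]
  have h : Spec.map (CommRingCat.ofHom φ') ≫ divι f = Spec.map (CommRingCat.ofHom φ) := by
    rw [divι, ← Spec.map_comp, ← CommRingCat.ofHom_comp, Ideal.Quotient.lift_comp_mk]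
  refine ⟨IsOpenImmersion.lift ((divι f) ⁻¹ᵁ (centreCompl I)).ι (Spec.map (CommRingCat.ofHom φ')) ?_,
    by rw [divComplι, IsOpenImmersion.lift_fac_assoc, h]⟩
  rw [Scheme.Opens.range_ι]
  rintro _ ⟨x, rfl⟩
  change (Spec.map (CommRingCat.ofHom φ') ≫ divι f) x ∈ (PrimeSpectrum.zeroLocus (I : Set A))ᶜ
  rw [h]
  intro hx
  exact x.isPrime.ne_top (Ideal.eq_top_of_isUnit_mem _ (hx ha) hu)

theorem isUnit_of_basicOpen_eq_top {X : Scheme.{u}} (s : Γ(X, ⊤)) (h : X.basicOpen s = ⊤) :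
    IsUnit s := by
  have key : ∀ (U : X.Opens) (hU : U ≤ ⊤), U = ⊤ →
      IsUnit (X.presheaf.map (homOfLE hU).op s) → IsUnit s := by
    rintro _ hU rfl hs
    rwa [show homOfLE hU = 𝟙 _ from rfl, op_id, X.presheaf.map_id] at hs
  exact key _ _ h (X.toRingedSpace.isUnit_res_basicOpen s)

/-- On `V` the function `f = a · (f/a)` vanishes, and `a` is a unit because `V` avoids `V(I)` and
`a` generates `I` on the chart. Hence `f/a` vanishes, and so do its multiples, which include the
whole kernel of `properTransformAwayMap`. -/
theorem app_eq_zero {a f : A} (ha : a ∈ I) (hf : f ∈ I) {V : Scheme.{u}}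
    (q : V ⟶ Spec (.of (Away (reesGrading I) (reesT ha))))
    (h : V ⟶ ((divι f) ⁻¹ᵁ (centreCompl I)).toScheme)
    (w : q ≫ Spec.map (CommRingCat.ofHom (awayAlgebraMap ha)) = h ≫ divComplι I f)
    {x : Away (reesGrading I) (reesT ha)} (hx : properTransformAwayMap ha hf x = 0) :
    ((Scheme.ΓSpecIso _).inv ≫ q.appTop).hom x = 0 := by
  set ρ := ((Scheme.ΓSpecIso (.of (Away (reesGrading I) (reesT ha)))).inv ≫ q.appTop).hom
  have h0 : ρ (awayAlgebraMap ha f) = 0 := by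
    have e : CommRingCat.ofHom (awayAlgebraMap ha) ≫ (Scheme.ΓSpecIso _).inv ≫ q.appTop =
        CommRingCat.ofHom (Ideal.Quotient.mk (Ideal.span {f})) ≫ (Scheme.ΓSpecIso _).inv ≫
          (h ≫ Scheme.Opens.ι _).appTop := by
      rw [Scheme.ΓSpecIso_inv_naturality_assoc, Scheme.ΓSpecIso_inv_naturality_assoc,
        ← Scheme.Hom.comp_appTop, ← Scheme.Hom.comp_appTop, w]
      rfl
    have := congr($(e).hom f)
    refine this.trans ?_
    simp only [CommRingCat.hom_comp, CommRingCat.hom_ofHom, RingHom.comp_apply]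
    rw [Ideal.Quotient.eq_zero_iff_mem.mpr (Ideal.mem_span_singleton_self f), map_zero, map_zero]
  have h1 : IsUnit (ρ (awayAlgebraMap ha a)) := by
    apply isUnit_of_basicOpen_eq_top
    have e : V.basicOpen (ρ (awayAlgebraMap ha a)) =
        q ⁻¹ᵁ PrimeSpectrum.basicOpen (awayAlgebraMap ha a) := by
      refine (Scheme.preimage_basicOpen_top q _).symm.trans ?_
      exact congr_arg (fun U ↦ q ⁻¹ᵁ U) (basicOpen_eq_of_affine _)
    rw [e, eq_top_iff]
    intro v _ hv
    have : (q ≫ Spec.map (CommRingCat.ofHom (awayAlgebraMap ha))) v ∈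
        (PrimeSpectrum.zeroLocus (I : Set A))ᶜ := by
      rw [w]
      exact ((range_divComplι f).le ⟨h v, rfl⟩).2
    refine this fun c hc ↦ ?_
    change awayAlgebraMap ha c ∈ (q v).asIdeal
    rw [awayAlgebraMap_of_mem ha hc]
    exact Ideal.mul_mem_right _ _ hv
  obtain ⟨y, rfl⟩ := exists_eq_mul_of_properTransformAwayMap_eq_zero ha hf hx
  rw [awayAlgebraMap_of_mem ha hf, map_mul, h1.mul_right_eq_zero] at h0
  rw [map_mul, h0, zero_mul]

theorem exists_comp_Spec_map_eq {R S : Type u} [CommRing R] [CommRing S] {ψ : R →+* S}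
    (hψ : Function.Surjective ψ) {V : Scheme.{u}} (q : V ⟶ Spec (.of R))
    (hq : ∀ x, ψ x = 0 → ((Scheme.ΓSpecIso _).inv ≫ q.appTop).hom x = 0) :
    ∃ g, g ≫ Spec.map (CommRingCat.ofHom ψ) = q := by
  let ρ : S →+* Γ(V, ⊤) := ψ.liftOfSurjective hψ ⟨((Scheme.ΓSpecIso _).inv ≫ q.appTop).hom, hq⟩
  refine ⟨V.toSpecΓ ≫ Spec.map (CommRingCat.ofHom ρ), ?_⟩
  have h : CommRingCat.ofHom ψ ≫ CommRingCat.ofHom ρ = (Scheme.ΓSpecIso _).inv ≫ q.appTop := by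
    ext x
    exact ψ.liftOfRightInverse_comp_apply _ (Function.rightInverse_surjInv hψ) ⟨_, hq⟩ x
  rw [Category.assoc, ← Spec.map_comp, h, Spec.map_comp, ← Scheme.toSpecΓ_naturality_assoc]
  rw [← SpecMap_ΓSpecIso_hom, ← Spec.map_comp, Iso.inv_hom_id, Spec.map_id, Category.comp_id]

/-! ### Comparison of the ideal sheaves -/

variable {f : A} (hf : f ∈ I)

/-- An injective ring map gives a schematically dominant morphism. It is applied to a localization
at a nonzerodivisor. -/
theorem ker_Spec_map_comp_of_injective {R S : Type u} [CommRing R] [CommRing S] {φ : R →+* S}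
    (hφ : Function.Injective φ) {X : Scheme.{u}} (g : Spec (.of R) ⟶ X) :
    (Spec.map (CommRingCat.ofHom φ) ≫ g).ker = g.ker := by
  have : (Spec.map (CommRingCat.ofHom φ)).ker = ⊥ := by
    refine Scheme.IdealSheafData.ext_of_isAffine ?_
    rw [Scheme.Hom.ker_apply]
    refine (RingHom.injective_iff_ker_eq_bot _).mp ?_
    have h := Scheme.ΓSpecIso_inv_naturality (CommRingCat.ofHom φ)
    have h' : (Spec.map (CommRingCat.ofHom φ)).appTop =
        (Scheme.ΓSpecIso _).hom ≫ CommRingCat.ofHom φ ≫ (Scheme.ΓSpecIso _).inv := by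
      rw [h, Iso.hom_inv_id_assoc]
    change Function.Injective (Spec.map (CommRingCat.ofHom φ)).appTop.hom
    rw [h', CommRingCat.hom_comp, CommRingCat.hom_comp]
    exact ((ConcreteCategory.bijective_of_isIso (Scheme.ΓSpecIso (.of S)).inv).1.comp hφ).comp
      (ConcreteCategory.bijective_of_isIso (Scheme.ΓSpecIso (.of R)).hom).1
  rw [Scheme.Hom.ker_comp, this, Scheme.IdealSheafData.map_bot]

/-- The affine chart `D₊(at)` of the blow-up, for `a ∈ I`. -/
def blowupChart {a : A} (ha : a ∈ I) :
    Spec (.of (Away (reesGrading I) (reesT ha))) ⟶ blowup I :=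
  Proj.awayι (reesGrading I) (reesT ha) (reesT_mem ha) one_pos

theorem blowupChart_blowupπ {a : A} (ha : a ∈ I) :
    blowupChart ha ≫ blowupπ I = Spec.map (CommRingCat.ofHom (awayAlgebraMap ha)) :=
  awayι_blowupπ ha

/-- The affine chart `D₊(at)` of the proper transform of `div f`, for `a ∈ I`. -/
def properTransformChart {a : A} (ha : a ∈ I) :
    Spec (.of (Away (quotientGrading (reesGrading I) (reesTIdeal hf))
      (quotientGradedHom (reesGrading I) (reesTIdeal hf) (reesT ha)))) ⟶ properTransform hf :=
  Proj.awayι _ _ ((quotientGradedHom _ (reesTIdeal hf)).map_mem (reesT_mem ha)) one_pos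

theorem properTransformChart_properTransformι {a : A} (ha : a ∈ I) :
    properTransformChart hf ha ≫ properTransformι hf =
      Spec.map (CommRingCat.ofHom (properTransformAwayMap ha hf)) ≫ blowupChart ha :=
  Proj.awayι_comp_map _ (irrelevant_le_map_quotientGradedHom _ _) one_pos _ (reesT_mem ha)

theorem properTransformAwayMap_surjective {a : A} (ha : a ∈ I) :
    Function.Surjective (properTransformAwayMap ha hf) :=
  quotientGradedHom_awayMap_surjective _ (reesTIdeal hf) (reesT_mem ha)

/-- The cover of the blow-up by the charts `D₊(aᵢt)`, where the `aᵢ` generate `I`. -/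
def blowupCover {ι : Type u} {a : ι → A} (ha : ∀ i, a i ∈ I)
    (hI : I ≤ Ideal.span (Set.range a)) : (blowup I).OpenCover :=
  (Proj.affineOpenCoverOfIrrelevantLESpan (reesGrading I) _
    (fun i ↦ reesT_mem (ha i)) (fun _ ↦ one_pos) (irrelevant_le_span_reesT a ha hI)).openCover

/-- The cover of the proper transform by the charts `D₊(aᵢt)`, where the `aᵢ` generate `I`. -/
def properTransformCover {ι : Type u} {a : ι → A} (ha : ∀ i, a i ∈ I)
    (hI : I ≤ Ideal.span (Set.range a)) : (properTransform hf).OpenCover :=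
  (Proj.affineOpenCoverOfIrrelevantLESpan (quotientGrading _ (reesTIdeal hf)) _
    (fun i ↦ (quotientGradedHom _ (reesTIdeal hf)).map_mem (reesT_mem (ha i))) (fun _ ↦ one_pos)
    (by
      refine (show _ ≤ (HomogeneousIdeal.map (quotientGradedHom _ (reesTIdeal hf)) _).toIdeal from
        irrelevant_le_map_quotientGradedHom _ (reesTIdeal hf)).trans ?_
      refine (Ideal.map_mono (irrelevant_le_span_reesT a ha hI)).trans ?_
      rw [Ideal.map_span, ← Set.range_comp]
      rfl)).openCover

/-- By `app_eq_zero`, any `V` lying in a chart and over `D \ V(I)` maps through the proper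
transform. -/
theorem ker_comp_le_of_blowupChart {V : Scheme.{u}} {a : A} (ha : a ∈ I) (p : V ⟶ blowup I)
    (q : V ⟶ Spec (.of (Away (reesGrading I) (reesT ha)))) (hq : p = q ≫ blowupChart ha)
    (h : V ⟶ ((divι f) ⁻¹ᵁ (centreCompl I)).toScheme) (w : p ≫ blowupπ I = h ≫ divComplι I f) :
    (properTransformι hf).ker ≤ p.ker := by
  obtain ⟨g, hg⟩ := exists_comp_Spec_map_eq (properTransformAwayMap_surjective hf ha) q
    fun x hx ↦ app_eq_zero ha hf q h (by
      rw [← w, hq, Category.assoc, blowupChart_blowupπ]) hx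
  rw [hq, ← hg, Category.assoc, ← properTransformChart_properTransformι, ← Category.assoc]
  exact Scheme.Hom.le_ker_comp _ _

theorem ker_properTransformι_le {ι : Type u} {a : ι → A} (ha : ∀ i, a i ∈ I)
    (hI : I ≤ Ideal.span (Set.range a)) (hfg : I.FG) :
    (properTransformι hf).ker ≤ (pullback.fst (blowupπ I) (divComplι I f)).ker := by
  have := quasiCompact_divComplι hfg f
  rw [← (pullback.fst (blowupπ I) (divComplι I f)).iInf_ker_openCover_map_comp
    ((blowupCover ha hI).pullback₁ (pullback.fst (blowupπ I) (divComplι I f)))]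
  refine le_iInf fun i ↦ ker_comp_le_of_blowupChart hf (ha i) _ (pullback.snd _ _)
    pullback.condition
    (((blowupCover ha hI).pullback₁ (pullback.fst (blowupπ I) (divComplι I f))).f i ≫
      pullback.snd (blowupπ I) (divComplι I f)) ?_
  rw [Category.assoc, Category.assoc, ← pullback.condition]

/-- Since `φ a` is regular, inverting it leaves the kernel of `g` unchanged; after inversion, `g`
factors through the inverse image of `D \ V(I)`. -/
theorem ker_pullback_fst_divComplι_le {X : Scheme.{u}} (π : X ⟶ Spec (.of A)) {R : Type u}
    [CommRing R] (φ : A →+* R) (g : Spec (.of R) ⟶ X) (hg : g ≫ π = Spec.map (CommRingCat.ofHom φ))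
    {a : A} (ha : a ∈ I) (hφ : φ f = 0) (hr : ∀ y, φ a * y = 0 → y = 0) :
    (pullback.fst π (divComplι I f)).ker ≤ g.ker := by
  let θ := algebraMap R (Localization.Away (φ a))
  have hθ : Function.Injective θ := by
    refine IsLocalization.injective _ (M := .powers (φ a)) ?_
    refine Submonoid.powers_le.mpr (mem_nonZeroDivisors_iff_right.mpr fun y hy ↦ hr y ?_)
    rwa [mul_comm]
  rw [← ker_Spec_map_comp_of_injective hθ]
  obtain ⟨h, hh⟩ := exists_comp_divComplι_eq (θ.comp φ) ha (f := f)
    (by rw [RingHom.comp_apply, hφ, map_zero]) (IsLocalization.Away.algebraMap_isUnit (φ a))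
  have hw : (Spec.map (CommRingCat.ofHom θ) ≫ g) ≫ π = h ≫ divComplι I f := by
    rw [Category.assoc, hg, hh, ← Spec.map_comp]
    rfl
  rw [← pullback.lift_fst _ _ hw]
  exact Scheme.Hom.le_ker_comp _ _

theorem eq_zero_of_map_mul_eq_zero {R S : Type*} [CommRing R] [CommRing S] (ψ : R →+* S)
    (hψ : Function.Surjective ψ) {s : R} (h : ∀ x, ψ (s * x) = 0 → ψ x = 0) {y : S}
    (hy : ψ s * y = 0) : y = 0 := by
  obtain ⟨x, rfl⟩ := hψ y
  exact h x (by rw [map_mul, hy])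

theorem ker_le_properTransformChart_comp (hfI : ∀ m x, f * x ∈ I ^ (m + 1) → x ∈ I ^ m) {a : A}
    (ha : a ∈ I) : (pullback.fst (blowupπ I) (divComplι I f)).ker ≤
      (properTransformChart hf ha ≫ properTransformι hf).ker := by
  refine ker_pullback_fst_divComplι_le (blowupπ I)
    ((properTransformAwayMap ha hf).comp (awayAlgebraMap ha)) _ ?_ ha ?_ fun y hy ↦ ?_
  · rw [properTransformChart_properTransformι, Category.assoc, blowupChart_blowupπ,
      CommRingCat.ofHom_comp, Spec.map_comp]
  · rw [RingHom.comp_apply, awayAlgebraMap_of_mem ha hf, map_mul,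
      properTransformAwayMap_reesFraction_self, mul_zero]
  · exact eq_zero_of_map_mul_eq_zero _ (properTransformAwayMap_surjective hf ha)
      (fun x hx ↦ properTransformAwayMap_eq_zero_of_mul ha hf hfI hx) hy

theorem le_ker_properTransformι {ι : Type u} {a : ι → A} (ha : ∀ i, a i ∈ I)
    (hI : I ≤ Ideal.span (Set.range a)) (hfI : ∀ m x, f * x ∈ I ^ (m + 1) → x ∈ I ^ m) :
    (pullback.fst (blowupπ I) (divComplι I f)).ker ≤ (properTransformι hf).ker := by
  rw [← (properTransformι hf).iInf_ker_openCover_map_comp (properTransformCover hf ha hI)]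
  exact le_iInf fun i ↦ ker_le_properTransformChart_comp hf hfI (ha i)

end AffineModification

end

/-! ### Conclusion -/

open AffineModification in
theorem mainTheorem4 {A : Type u} [CommRing A] {r : ℕ} (a : Fin (r + 1) → A)
    (ha : RingTheory.Sequence.IsWeaklyRegular A (List.ofFn a))
    (I : Ideal A) (hI : I = Ideal.span (Set.range a)) (hf : a 0 ∈ I) :
    (∃ e : AffineModification.properTransform hf ≅ AffineModification.strictTransform I (a 0),
      e.hom ≫ AffineModification.strictTransformι I (a 0) =
        AffineModification.properTransformι hf) ∧
    Set.range (AffineModification.properTransformι hf) =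
      closure ((AffineModification.blowupπ I) ⁻¹'
        (PrimeSpectrum.zeroLocus {a 0} \ PrimeSpectrum.zeroLocus (I : Set A))) := by
  have hfg : I.FG := hI ▸ Submodule.fg_span (Set.finite_range a)
  have haI (i) : a i ∈ I := hI ▸ Ideal.subset_span ⟨i, rfl⟩
  -- The open covers are indexed by a type in the universe of `A`, hence the lift of `Fin (r + 1)`.
  have hspan : I ≤ Ideal.span (Set.range fun i : ULift.{u} (Fin (r + 1)) ↦ a i.down) := by
    rw [hI, show (fun i : ULift.{u} (Fin (r + 1)) ↦ a i.down) = a ∘ ULift.down from rfl,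
      ULift.down_surjective.range_comp a]
  have hreg : ∀ m x, a 0 * x ∈ I ^ (m + 1) → x ∈ I ^ m := by
    intro m x hx
    rw [List.ofFn_succ] at ha
    have h : I = Ideal.ofList (a 0 :: List.ofFn fun i : Fin r ↦ a i.succ) := by
      rw [hI, ← List.ofFn_succ, Ideal.ofList]
      congr 1
      ext x
      simp [List.mem_ofFn, Fin.exists_fin_succ, eq_comm]
    rw [h] at hx ⊢
    exact ha.mem_ofList_cons_pow m hx
  have := quasiCompact_divComplι hfg (a 0)
  have hker : (pullback.fst (blowupπ I) (divComplι I (a 0))).ker = (properTransformι hf).ker :=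
    (le_ker_properTransformι hf (fun i : ULift.{u} (Fin (r + 1)) ↦ haI i.down) hspan hreg).antisymm
      (ker_properTransformι_le hf (fun i : ULift.{u} (Fin (r + 1)) ↦ haI i.down) hspan hfg)
  have hcl : IsClosedImmersion (strictTransformι I (a 0)) := by
    unfold strictTransformι strictTransform; infer_instance
  have hker' : (strictTransformι I (a 0)).ker = (properTransformι hf).ker :=
    (Scheme.IdealSheafData.ker_subschemeι _).trans hker
  have := IsClosedImmersion.isIso_lift _ _ hker'
  refine ⟨⟨asIso (IsClosedImmersion.lift _ _ hker'.le), IsClosedImmersion.lift_fac _ _ _⟩, ?_⟩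
  -- For a quasi-compact morphism the support of the kernel is the closure of the image, so equality
  -- of kernels also gives the topological statement.
  rw [← (properTransformι hf).isClosedEmbedding.isClosed_range.closure_eq,
    ← Scheme.Hom.support_ker, ← hker, Scheme.Hom.support_ker, Scheme.Pullback.range_fst,
    range_divComplι]
  rfl
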